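/- **Theorem (a bibasic Heine transformation formula, $A_n\to A_m$).** Let $n,m$ be positive integers, let $q\neq 0$ and $h,t$ be complex numbers, fix a value $\log q$ of the logarithm of $q$, and put $q^{\alpha}:=e^{\alpha\log q}$ for $\alpha\in\mathbb C$. For $|p|<1$ let $$(A;p)_\infty=\prod_{i\ge 0}(1-Ap^i),\qquad (A;p)_k=\prod_{i=0}^{k-1}(1-Ap^i)\quad(k\in\mathbb Z_{\ge0}),$$ and, for a base $q^{\beta}$ with $|q^\beta|<1$ and a complex index $\alpha$, let $$(A;q^\beta)_\alpha=\frac{(A;q^\beta)_\infty}{(Aq^{\beta\alpha};q^\beta)_\infty},\qquad \frac1{(A;q^\beta)_\alpha}=\frac{(Aq^{\beta\alpha};q^\beta)_\infty}{(A;q^\beta)_\infty}.$$ For $k=(k_1,\dots,k_n)$ write $|k|=k_1+\dots+k_n$ and $e_2(k)=\sum_{r<s}k_rk_s$, and similarly for $j=(j_1,\dots,j_m)$. Suppose $0<|q^h|<1$, $0<|q^t|<1$ and $0<|q^{ht}|<1$. Let $x_1,\dots,x_n$, $y_1,\dots,y_m$ be nonzero complex numbers and let $a_1,\dots,a_n$,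 $b_1,\dots,b_m$, $z$, $w$ be complex numbers with $|z/x_r|<1$ for $r=1,\dots,n$ and $|w/y_r|<1$ for $r=1,\dots,m$. Suppose that no denominator below vanishes, that is, for all integers $i\ge0$: $q^{hi}x_r/x_s\ne1$ and $q^{ti}y_r/y_s\neq 1$ whenever $r\ne s$, $\;q^{hi}a_rz/x_r\ne1$ for $1\le r\le n$, and $q^{ti}b_rw/y_r\neq1$ for $1\le r\le m$. Then both multiple series below converge absolutely, and $$\begin{aligned} \sum_{k_1,\dots,k_n\ge0}\Bigg(&\prod_{1\le r<s\le n}\frac{1-q^{h(k_r-k_s)}x_r/x_s}{1-x_r/x_s}\ \prod_{r,s=1}^{n}\frac{(a_sx_r/x_s;q^h)_{k_r}}{(q^hx_r/x_s;q^h)_{k_r}}\\ &\times\prod_{r=1}^{m}\frac{(w/y_r;q^t)_{h|k|}}{(b_rw/y_r;q^t)_{h|k|}}\cdot z^{|k|}\,q^{h\sum_{r=1}^n(r-1)k_r}\,q^{h\,e_2(k)}\prod_{r=1}^n x_r^{-k_r}\Bigg)\\ =\ \prod_{r=1}^{m}&\frac{(w/y_r;q^t)_\infty}{(b_rw/y_r;q^t)_\infty}\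 \prod_{r=1}^{n}\frac{(a_rz/x_r;q^h)_\infty}{(z/x_r;q^h)_\infty}\\ \times\sum_{j_1,\dots,j_m\ge0}\Bigg(&\prod_{1\le r<s\le m}\frac{1-q^{t(j_r-j_s)}y_r/y_s}{1-y_r/y_s}\ \prod_{r,s=1}^{m}\frac{(b_sy_r/y_s;q^t)_{j_r}}{(q^ty_r/y_s;q^t)_{j_r}}\\ &\times\prod_{r=1}^{n}\frac{(z/x_r;q^h)_{t|j|}}{(a_rz/x_r;q^h)_{t|j|}}\cdot w^{|j|}\,q^{t\sum_{r=1}^m(r-1)j_r}\,q^{t\,e_2(j)}\prod_{r=1}^m y_r^{-j_r}\Bigg). \end{aligned}$$ -/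

import Mathlib

open scoped BigOperators

noncomputable section

/-- The power `q ^ α` for a complex exponent `α`, where `q = exp logq` and `logq` is the chosen
value of the logarithm of `q`. -/
def qPow (logq α : ℂ) : ℂ := Complex.exp (α * logq)

/-- The infinite rising factorial `(A; p)_∞ = ∏_{i ≥ 0} (1 - A p^i)` (used for `|p| < 1`). -/
def qFacInf (A p : ℂ) : ℂ := ∏' i : ℕ, (1 - A * p ^ i)

/-- The finite rising factorial `(A; p)_k = (1 - A)(1 - A p) ⋯ (1 - A p^(k-1))`. -/
def qFac (A p : ℂ) (k : ℕ) : ℂ := ∏ i ∈ Finset.range k, (1 - A * p ^ i)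

/-- The rising factorial with base `q^β` and an arbitrary complex index `α`,
`(A; q^β)_α = (A; q^β)_∞ / (A q^(β α); q^β)_∞`. With Lean's convention `c / 0 = 0` its inverse is
`(A q^(β α); q^β)_∞ / (A; q^β)_∞` whenever `(A; q^β)_∞ ≠ 0`, also if `(A q^(β α); q^β)_∞ = 0`. -/
def qFacGen (logq β A α : ℂ) : ℂ :=
  qFacInf A (qPow logq β) / qFacInf (A * qPow logq (β * α)) (qPow logq β)

/-- The sum `|k| = k_1 + ⋯ + k_n`. -/
def vecSum {n : ℕ} (k : Fin n → ℕ) : ℕ := ∑ r, k r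

/-- The elementary symmetric function `e_2(k) = ∑_{r < s} k_r k_s`. -/
def vecE2 {n : ℕ} (k : Fin n → ℕ) : ℕ := ∑ r, ∑ s ∈ Finset.Ioi r, k r * k s

/-- The Vandermonde factor of type `A` with base `p`:
`∏_{r < s} (1 - p^(k_r - k_s) x_r / x_s) / (1 - x_r / x_s)`. -/
def vandermondeFactor {n : ℕ} (p : ℂ) (x : Fin n → ℂ) (k : Fin n → ℕ) : ℂ :=
  ∏ r, ∏ s ∈ Finset.Ioi r,
    (1 - p ^ ((k r : ℤ) - (k s : ℤ)) * (x r / x s)) / (1 - x r / x s)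

/-- The summand, with base `p`, of the Milne–Lilly type series:
the Vandermonde factor times
`∏_{r,s} (a_s x_r/x_s; p)_{k_r} / (p x_r/x_s; p)_{k_r}`
times `z^|k| p^(∑ (r-1) k_r) p^(e_2(k)) ∏_r x_r^(-k_r)`.
(The index `r : Fin n` starts at `0`, so it plays the role of `r - 1`.) -/
def milneLillyTerm {n : ℕ} (p : ℂ) (x a : Fin n → ℂ) (z : ℂ) (k : Fin n → ℕ) : ℂ :=
  vandermondeFactor p x k *
    (∏ r, ∏ s, qFac (a s * (x r / x s)) p (k r) / qFac (p * (x r / x s)) p (k r)) *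
    z ^ vecSum k * p ^ (∑ r : Fin n, (r : ℕ) * k r) * p ^ vecE2 k * ∏ r, ((x r) ^ k r)⁻¹

/-- The summand of the `n`-fold series: `milneLillyTerm` with base `q^h`, times
`∏_{r=1}^m (w/y_r; q^t)_{h|k|} / (b_r w/y_r; q^t)_{h|k|}`. The summand of the `m`-fold series is
the same expression with the roles of `(n, h, x, a, z)` and `(m, t, y, b, w)` exchanged. -/
def heineTerm {n m : ℕ} (logq h t : ℂ) (x a : Fin n → ℂ) (z : ℂ)
    (y b : Fin m → ℂ) (w : ℂ) (k : Fin n → ℕ) : ℂ :=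
  milneLillyTerm (qPow logq h) x a z k *
    ∏ r, qFacGen logq t (w / y r) (h * (vecSum k : ℂ)) /
      qFacGen logq t (b r * (w / y r)) (h * (vecSum k : ℂ))

end

noncomputable section

open Finset Filter Topology

theorem qFac_zero (A p : ℂ) : qFac A p 0 = 1 := by simp [qFac]

theorem qFac_succ (A p : ℂ) (k : ℕ) : qFac A p (k + 1) = qFac A p k * (1 - A * p ^ k) :=
  prod_range_succ _ _

theorem qFac_mul_shift (A p : ℂ) (k : ℕ) :
    qFac (p * A) p k * (1 - A) = qFac A p k * (1 - A * p ^ k) := by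
  rw [← qFac_succ, qFac, qFac, prod_range_succ']
  simp only [pow_zero, mul_one, pow_succ]
  congr 1
  exact prod_congr rfl fun i _ => by ring

@[to_additive]
theorem prod_prod_Ioi_ite {M : Type*} [CommMonoid M] {n : ℕ} (s : Fin n) (g : Fin n → M) :
    ∏ i, ∏ j ∈ Ioi i, ((if i = s then g j else 1) * (if j = s then g i else 1)) =
      ∏ t ∈ univ.erase s, g t := by
  have h1 : ∏ i, ∏ j ∈ Ioi i, (if i = s then g j else 1) = ∏ j ∈ Ioi s, g j := by
    rw [Fintype.prod_eq_single s fun i hi => prod_eq_one fun j _ => if_neg hi]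
    simp
  have h2 : ∏ i, ∏ j ∈ Ioi i, (if j = s then g i else 1) = ∏ i ∈ Iio s, g i := by
    rw [prod_congr rfl fun i _ => prod_ite_eq' (Ioi i) s fun _ => g i, ← prod_filter]
    congr 1
    ext i
    simp
  simp_rw [prod_mul_distrib]
  rw [h1, h2, ← prod_union]
  · congr 1
    ext i
    simp [lt_or_lt_iff_ne, eq_comm]
  · exact disjoint_left.2 fun i hi hj => lt_asymm (mem_Ioi.1 hi) (mem_Iio.1 hj)

/-- The shifted variables `x_r p^(k_r)`. -/
def shiftVar {n : ℕ} (p : ℂ) (x : Fin n → ℂ) (k : Fin n → ℕ) (r : Fin n) : ℂ := p ^ k r * x r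

theorem shiftVar_injective {n : ℕ} {p : ℂ} (hp : p ≠ 0) {x : Fin n → ℂ} (hx : ∀ r, x r ≠ 0)
    (hxx : ∀ r s, r ≠ s → ∀ i : ℕ, p ^ i * (x r / x s) ≠ 1) (k : Fin n → ℕ) :
    Function.Injective (shiftVar p x k) := by
  have key : ∀ r s, r ≠ s → k s ≤ k r → shiftVar p x k r ≠ shiftVar p x k s := by
    intro r s hrs hk h
    obtain ⟨i, hi⟩ := Nat.exists_eq_add_of_le hk
    apply hxx r s hrs i
    simp only [shiftVar, hi, pow_add, mul_assoc] at h
    have := mul_left_cancel₀ (pow_ne_zero _ hp) h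
    rw [← mul_div_assoc, this, div_self (hx s)]
  intro r s h
  by_contra hrs
  rcases le_total (k r) (k s) with hk | hk
  · exact key s r (Ne.symm hrs) hk h.symm
  · exact key r s hrs hk h

theorem vandermondeFactor_mul_pow {n : ℕ} {p : ℂ} (hp : p ≠ 0) {x : Fin n → ℂ}
    (hx : ∀ r, x r ≠ 0) (k : Fin n → ℕ) :
    vandermondeFactor p x k * p ^ (∑ r : Fin n, (r : ℕ) * k r) =
      ∏ r, ∏ s ∈ Ioi r, (shiftVar p x k s - shiftVar p x k r) / (x s - x r) := by
  have h : ∑ r : Fin n, (r : ℕ) * k r = ∑ r, ∑ s ∈ Ioi r, k s := by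
    rw [sum_comm' (t' := univ) (s' := fun s => Iio s) (by simp)]
    simp
  rw [h, ← prod_pow_eq_pow_sum]
  simp_rw [← prod_pow_eq_pow_sum]
  rw [vandermondeFactor, ← prod_mul_distrib]
  refine prod_congr rfl fun r _ => ?_
  rw [← prod_mul_distrib]
  refine prod_congr rfl fun s _ => ?_
  have h1 : 1 - x r / x s = (x s - x r) / x s := by rw [sub_div, div_self (hx s)]
  rw [h1, div_div_eq_mul_div, div_mul_eq_mul_div]
  congr 1
  rw [zpow_sub₀ hp, zpow_natCast, zpow_natCast, shiftVar, shiftVar]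
  have := pow_ne_zero (k s) hp
  have := hx s
  field_simp

theorem vecE2_add_single {n : ℕ} (k : Fin n → ℕ) (s : Fin n) :
    vecE2 (k + Pi.single s 1) = vecE2 k + ∑ t ∈ univ.erase s, k t := by
  rw [← sum_sum_Ioi_ite s k, vecE2, vecE2, ← sum_add_distrib]
  refine sum_congr rfl fun i _ => ?_
  rw [← sum_add_distrib]
  refine sum_congr rfl fun j hj => ?_
  have hij : i ≠ j := (mem_Ioi.1 hj).ne
  by_cases hi : i = s
  · subst hi
    simp [hij.symm]
    ring
  · by_cases hj : j = s
    · subst hj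
      simp [hij]
      ring
    · simp [hi, hj]

theorem vecSum_add_single {n : ℕ} (k : Fin n → ℕ) (s : Fin n) :
    vecSum (k + Pi.single s 1) = vecSum k + 1 := by
  simp [vecSum, sum_add_distrib]

theorem shiftVar_add_single_self {n : ℕ} (p : ℂ) (x : Fin n → ℂ) (k : Fin n → ℕ) (s : Fin n) :
    shiftVar p x (k + Pi.single s 1) s = p * shiftVar p x k s := by
  simp [shiftVar, pow_succ]; ring

theorem shiftVar_add_single_of_ne {n : ℕ} (p : ℂ) (x : Fin n → ℂ) (k : Fin n → ℕ) {s t : Fin n}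
    (h : t ≠ s) : shiftVar p x (k + Pi.single s 1) t = shiftVar p x k t := by
  simp [shiftVar, h]

theorem prod_shiftVar_add_single {n : ℕ} {p : ℂ} (x : Fin n → ℂ)
    (k : Fin n → ℕ) (hinj : Function.Injective (shiftVar p x k)) (s : Fin n) :
    ∏ i, ∏ j ∈ Ioi i, (shiftVar p x (k + Pi.single s 1) j - shiftVar p x (k + Pi.single s 1) i) /
        (x j - x i) =
      (∏ i, ∏ j ∈ Ioi i, (shiftVar p x k j - shiftVar p x k i) / (x j - x i)) *
      ∏ t ∈ univ.erase s, (shiftVar p x k t - p * shiftVar p x k s) /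
        (shiftVar p x k t - shiftVar p x k s) := by
  rw [← prod_prod_Ioi_ite, ← prod_mul_distrib]
  refine prod_congr rfl fun i _ => ?_
  rw [← prod_mul_distrib]
  refine prod_congr rfl fun j hj => ?_
  have hij : i ≠ j := (mem_Ioi.1 hj).ne
  have h1 : shiftVar p x k j - shiftVar p x k i ≠ 0 := sub_ne_zero.2 (hinj.ne hij.symm)
  have h2 : shiftVar p x k i - shiftVar p x k j ≠ 0 := sub_ne_zero.2 (hinj.ne hij)
  by_cases hi : i = s
  · subst hi
    rw [shiftVar_add_single_self, shiftVar_add_single_of_ne _ _ _ hij.symm, if_pos rfl,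
      if_neg hij.symm, mul_one, div_mul_div_comm, mul_comm (_ - _) (_ - p * _),
      mul_div_mul_right _ _ h1]
  · by_cases hj : j = s
    · subst hj
      rw [shiftVar_add_single_self, shiftVar_add_single_of_ne _ _ _ hij, if_pos rfl,
        if_neg hij, one_mul, div_mul_div_comm, ← neg_sub (shiftVar p x k i) (shiftVar p x k j),
        ← neg_sub (shiftVar p x k i) (p * _), neg_mul, mul_comm (_ - _) (_ - p * _), ← neg_mul,
        mul_div_mul_right _ _ h2]
    · rw [shiftVar_add_single_of_ne _ _ _ hi, shiftVar_add_single_of_ne _ _ _ hj]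
      simp [hi, hj]

theorem prod_qFac_add_single {n : ℕ} (p : ℂ) (x c : Fin n → ℂ)
    (k : Fin n → ℕ) (s : Fin n) :
    ∏ r, ∏ t, qFac (c t * (x r / x t)) p ((k + Pi.single s 1 : Fin n → ℕ) r) =
      (∏ r, ∏ t, qFac (c t * (x r / x t)) p (k r)) *
        ∏ t, (1 - c t * (shiftVar p x k s / x t)) := by
  rw [← mul_prod_erase univ _ (mem_univ s),
    ← mul_prod_erase univ (fun r => ∏ t, qFac _ p (k r)) (mem_univ s), mul_right_comm,
    ← prod_mul_distrib]
  congr 1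
  · refine prod_congr rfl fun t _ => ?_
    simp only [Pi.add_apply, Pi.single_eq_same, qFac_succ, shiftVar]
    ring
  · refine prod_congr rfl fun r hr => ?_
    simp [(mem_erase.1 hr).1]

theorem milneLillyTerm_eq {n : ℕ} {p : ℂ} (hp : p ≠ 0) {x : Fin n → ℂ}
    (hx : ∀ r, x r ≠ 0) (a : Fin n → ℂ) (z : ℂ) (k : Fin n → ℕ) :
    milneLillyTerm p x a z k =
      (∏ i, ∏ j ∈ Ioi i, (shiftVar p x k j - shiftVar p x k i) / (x j - x i)) *
      ((∏ r, ∏ s, qFac (a s * (x r / x s)) p (k r)) /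
        ∏ r, ∏ s, qFac (p * (x r / x s)) p (k r)) *
      z ^ vecSum k * p ^ vecE2 k * ∏ r, ((x r) ^ k r)⁻¹ := by
  rw [← vandermondeFactor_mul_pow hp hx, milneLillyTerm]
  simp_rw [prod_div_distrib]
  ring

theorem milneLillyTerm_add_single {n : ℕ} {p : ℂ} (hp : p ≠ 0) {x : Fin n → ℂ}
    (hx : ∀ r, x r ≠ 0) (hxx : ∀ r s, r ≠ s → ∀ i : ℕ, p ^ i * (x r / x s) ≠ 1)
    (a : Fin n → ℂ) (z : ℂ) (k : Fin n → ℕ) (s : Fin n) :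
    milneLillyTerm p x a z (k + Pi.single s 1) = milneLillyTerm p x a z k *
      (∏ t ∈ univ.erase s, (shiftVar p x k t - p * shiftVar p x k s) /
        (shiftVar p x k t - shiftVar p x k s)) *
      ((∏ t, (1 - a t * (shiftVar p x k s / x t))) /
        ∏ t, (1 - p * (shiftVar p x k s / x t))) *
      (z * (x s)⁻¹ * ∏ t ∈ univ.erase s, p ^ k t) := by
  have h : ∏ r, ((x r) ^ (k + Pi.single s 1 : Fin n → ℕ) r)⁻¹ = (∏ r, ((x r) ^ k r)⁻¹) * (x s)⁻¹ := by
    rw [← mul_prod_erase univ _ (mem_univ s),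
      ← mul_prod_erase univ (fun r => ((x r) ^ k r)⁻¹) (mem_univ s), mul_right_comm]
    congr 1
    · simp [pow_succ, mul_comm]
    · refine prod_congr rfl fun r hr => ?_
      simp [(mem_erase.1 hr).1]
  rw [milneLillyTerm_eq hp hx, milneLillyTerm_eq hp hx, h, vecE2_add_single, vecSum_add_single,
    prod_qFac_add_single, prod_qFac_add_single p x (fun _ => p),
    prod_shiftVar_add_single x k (shiftVar_injective hp hx hxx k), pow_add p,
    ← prod_pow_eq_pow_sum, pow_succ]
  ring

/-- Lagrange interpolation of a polynomial of degree less than `n`. -/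
theorem eval_eq_sum_interpolation {n : ℕ} {X : Fin n → ℂ} (hX : Function.Injective X)
    {f : Polynomial ℂ} (hf : f.degree < n) (v : ℂ) :
    f.eval v = ∑ s, f.eval (X s) * ∏ t ∈ univ.erase s, (v - X t) / (X s - X t) := by
  have := Lagrange.eq_interpolate (s := univ) (v := X) (f := f) hX.injOn (by simpa using hf)
  conv_lhs => rw [this]
  rw [Lagrange.interpolate_apply, Polynomial.eval_finsetSum]
  refine sum_congr rfl fun s _ => ?_
  rw [Polynomial.eval_mul, Polynomial.eval_C, Lagrange.basis, Polynomial.eval_prod]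
  congr 1
  refine prod_congr rfl fun t _ => ?_
  simp [Lagrange.basisDivisor, div_eq_inv_mul]

theorem prod_sub_prod_eq_sum {n : ℕ} {X : Fin n → ℂ} (hX : Function.Injective X)
    (x : Fin n → ℂ) (α : ℂ) :
    ∏ t, (1 - α * x t) - ∏ t, (1 - α * X t) =
      ∑ s, α * (∏ t, (X s - x t)) * ∏ t ∈ univ.erase s, (1 - α * X t) / (X s - X t) := by
  rcases eq_or_ne α 0 with rfl | hα
  · simp
  rcases Nat.eq_zero_or_pos n with rfl | hn
  · simp
  have hcard : ∀ s : Fin n, α ^ n = α * ∏ t ∈ univ.erase s, α := by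
    intro s
    rw [mul_prod_erase univ (fun _ => α) (mem_univ s)]
    simp
  have hprod : ∀ y : Fin n → ℂ, ∏ t, (1 - α * y t) = α ^ n * ∏ t, (α⁻¹ - y t) := by
    intro y
    have : α ^ n = ∏ _t : Fin n, α := by simp
    rw [this, ← prod_mul_distrib]
    exact prod_congr rfl fun t _ => by field_simp
  have hm : ∀ y : Fin n → ℂ, (∏ t, (Polynomial.X - Polynomial.C (y t))).Monic := fun y =>
    Polynomial.monic_prod_of_monic _ _ fun t _ => Polynomial.monic_X_sub_C _
  have hd : ∀ y : Fin n → ℂ, (∏ t, (Polynomial.X - Polynomial.C (y t))).degree = (n : WithBot ℕ) := fun y => by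
    simp [Polynomial.degree_prod]
  have hdeg : (∏ t, (Polynomial.X - Polynomial.C (x t)) -
      ∏ t, (Polynomial.X - Polynomial.C (X t))).degree < (n : WithBot ℕ) := by
    rw [← hd x]
    exact Polynomial.degree_sub_lt_left ((hd x).trans (hd X).symm) (hm x).ne_zero
      ((hm x).leadingCoeff.trans (hm X).leadingCoeff.symm)
  have := eval_eq_sum_interpolation hX hdeg α⁻¹
  simp only [Polynomial.eval_sub, Polynomial.eval_prod, Polynomial.eval_X,
    Polynomial.eval_C] at this
  rw [hprod x, hprod X, ← mul_sub, this, mul_sum]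
  refine sum_congr rfl fun s _ => ?_
  rw [prod_eq_zero (f := fun t => X s - X t) (mem_univ s) (sub_self _), sub_zero, hcard s]
  have : ∏ t ∈ univ.erase s, (1 - α * X t) / (X s - X t) =
      (∏ t ∈ univ.erase s, α) * ∏ t ∈ univ.erase s, (α⁻¹ - X t) / (X s - X t) := by
    rw [← prod_mul_distrib]
    exact prod_congr rfl fun t _ => by field_simp
  rw [this]
  ring

theorem sum_prod_div_eq_one {n : ℕ} {X : Fin n → ℂ} (hX : Function.Injective X)
    (β : Fin n → ℂ) (r : Fin n) :
    ∑ s, (∏ t ∈ univ.erase r, (1 - β t * X s)) *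
      ∏ t ∈ univ.erase s, X t / (X t - X s) = 1 := by
  have hdeg : (∏ t ∈ univ.erase r, (1 - Polynomial.C (β t) * Polynomial.X)).degree < (n : WithBot ℕ) := by
    refine (Polynomial.degree_prod_le _ _).trans_lt ?_
    have h1 : ∀ t ∈ univ.erase r,
        (1 - Polynomial.C (β t) * Polynomial.X : Polynomial ℂ).degree ≤ 1 := fun t _ => by
      compute_degree
    refine (sum_le_sum h1).trans_lt ?_
    have : #(univ.erase r) < n := by
      simpa using card_erase_lt_of_mem (mem_univ r)
    simpa using this
  have := eval_eq_sum_interpolation hX hdeg 0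
  simp only [Polynomial.eval_sub, Polynomial.eval_prod, Polynomial.eval_X, Polynomial.eval_mul,
    Polynomial.eval_one, Polynomial.eval_C, mul_zero, sub_zero, prod_const_one] at this
  refine Eq.trans (sum_congr rfl fun s _ => ?_) this.symm
  congr 1
  refine prod_congr rfl fun t _ => ?_
  rw [zero_sub, ← neg_sub (X t) (X s), neg_div_neg_eq]

theorem prod_prod_qFac_update {n : ℕ} (p : ℂ) (x a : Fin n → ℂ) (k : Fin n → ℕ) (r : Fin n) :
    (∏ i, ∏ s, qFac (Function.update a r (p * a r) s * (x i / x s)) p (k i)) *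
        ∏ t, (1 - a r * (x t / x r)) =
      (∏ i, ∏ s, qFac (a s * (x i / x s)) p (k i)) *
        ∏ t, (1 - a r * (shiftVar p x k t / x r)) := by
  rw [← prod_mul_distrib, ← prod_mul_distrib]
  refine prod_congr rfl fun i _ => ?_
  have h : ∏ s ∈ univ.erase r, qFac (Function.update a r (p * a r) s * (x i / x s)) p (k i) =
      ∏ s ∈ univ.erase r, qFac (a s * (x i / x s)) p (k i) :=
    prod_congr rfl fun s hs => by rw [Function.update_of_ne (mem_erase.1 hs).1]
  have h1 := qFac_mul_shift (a r * (x i / x r)) p (k i)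
  rw [← mul_prod_erase univ _ (mem_univ r),
    ← mul_prod_erase univ (fun s => qFac (a s * (x i / x s)) p (k i)) (mem_univ r), h,
    Function.update_self, shiftVar, mul_assoc p]
  linear_combination (∏ s ∈ univ.erase r, qFac (a s * (x i / x s)) p (k i)) * h1

theorem milneLillyTerm_update {n : ℕ} {p : ℂ} (hp : p ≠ 0) {x : Fin n → ℂ}
    (hx : ∀ r, x r ≠ 0) (a : Fin n → ℂ) (z : ℂ) (k : Fin n → ℕ) (r : Fin n) :
    milneLillyTerm p x (Function.update a r (p * a r)) z k * ∏ t, (1 - a r * (x t / x r)) =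
      milneLillyTerm p x a z k * ∏ t, (1 - a r * (shiftVar p x k t / x r)) := by
  rw [milneLillyTerm_eq hp hx, milneLillyTerm_eq hp hx]
  linear_combination (exp := 1)
    (∏ i, ∏ j ∈ Ioi i, (shiftVar p x k j - shiftVar p x k i) / (x j - x i)) *
      (∏ r, ∏ s, qFac (p * (x r / x s)) p (k r))⁻¹ *
      z ^ vecSum k * p ^ vecE2 k * (∏ r, ((x r) ^ k r)⁻¹) * prod_prod_qFac_update p x a k r

theorem one_sub_shiftVar_ne_zero {n : ℕ} {p : ℂ} (hp1 : ‖p‖ < 1)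
    {x : Fin n → ℂ} (hx : ∀ r, x r ≠ 0)
    (hxx : ∀ r s, r ≠ s → ∀ i : ℕ, p ^ i * (x r / x s) ≠ 1) (r s : Fin n) (i : ℕ) :
    1 - p * (x r / x s) * p ^ i ≠ 0 := by
  intro h
  have h1 : p ^ (i + 1) * (x r / x s) = 1 := by rw [pow_succ]; linear_combination -h
  rcases eq_or_ne r s with rfl | hrs
  · rw [div_self (hx r), mul_one] at h1
    have := pow_lt_one₀ (norm_nonneg p) hp1 (Nat.succ_ne_zero i)
    rw [← norm_pow, h1] at this
    simp at this
  · exact hxx r s hrs _ h1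

/-- The summand obtained by partial fractions: `s`-th contribution at the lowered multi-index. -/
def partialTerm {n : ℕ} (p : ℂ) (x a : Fin n → ℂ) (z : ℂ) (r s : Fin n) (k : Fin n → ℕ) : ℂ :=
  -(a r * (x r)⁻¹ * z) * milneLillyTerm p x (Function.update a r (p * a r)) z k *
    ((∏ t ∈ univ.erase r, (1 - a t * (x t)⁻¹ * shiftVar p x k s)) *
      ∏ t ∈ univ.erase s, shiftVar p x k t / (shiftVar p x k t - shiftVar p x k s))

theorem sum_partialTerm {n : ℕ} {p : ℂ} (hp : p ≠ 0) {x : Fin n → ℂ}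
    (hx : ∀ r, x r ≠ 0) (hxx : ∀ r s, r ≠ s → ∀ i : ℕ, p ^ i * (x r / x s) ≠ 1)
    (a : Fin n → ℂ) (z : ℂ) (k : Fin n → ℕ) (r : Fin n) :
    ∑ s, partialTerm p x a z r s k =
      -(a r * (x r)⁻¹ * z) * milneLillyTerm p x (Function.update a r (p * a r)) z k := by
  simp only [partialTerm]
  rw [← mul_sum, sum_prod_div_eq_one (shiftVar_injective hp hx hxx k)
    (fun t => a t * (x t)⁻¹) r, mul_one]

theorem milneLillyTerm_mul_eq_partialTerm {n : ℕ} {p : ℂ} (hp : p ≠ 0) (hp1 : ‖p‖ < 1)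
    {x : Fin n → ℂ}
    (hx : ∀ r, x r ≠ 0) (hxx : ∀ r s, r ≠ s → ∀ i : ℕ, p ^ i * (x r / x s) ≠ 1)
    (a : Fin n → ℂ) (z : ℂ) (k : Fin n → ℕ) (r s : Fin n) :
    milneLillyTerm p x a z (k + Pi.single s 1) *
      (a r / x r * (∏ t, (shiftVar p x (k + Pi.single s 1) s - x t)) *
        ∏ t ∈ univ.erase s, (1 - a r / x r * shiftVar p x (k + Pi.single s 1) t) /
          (shiftVar p x (k + Pi.single s 1) s - shiftVar p x (k + Pi.single s 1) t)) =
    partialTerm p x a z r s k * ∏ t, (1 - a r * (x t / x r)) := by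
  have hinj := shiftVar_injective hp hx hxx (k + Pi.single s 1)
  have hinj' := shiftVar_injective hp hx hxx k
  have hA : ∏ t ∈ univ.erase s, (1 - a r / x r * shiftVar p x (k + Pi.single s 1) t) /
          (shiftVar p x (k + Pi.single s 1) s - shiftVar p x (k + Pi.single s 1) t) =
      (∏ t ∈ univ.erase s, (1 - a r * (shiftVar p x k t / x r))) *
        (∏ t ∈ univ.erase s, (-1 : ℂ)) *
        (∏ t ∈ univ.erase s, (shiftVar p x k t - p * shiftVar p x k s))⁻¹ := by
    rw [← prod_inv_distrib, ← prod_mul_distrib, ← prod_mul_distrib]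
    refine prod_congr rfl fun t ht => ?_
    rw [shiftVar_add_single_self, shiftVar_add_single_of_ne _ _ _ (mem_erase.1 ht).1,
      ← neg_sub (shiftVar p x k t), div_neg]
    ring
  have hB : ∏ t, (shiftVar p x (k + Pi.single s 1) s - x t) =
      (-1) * (∏ t ∈ univ.erase s, (-1 : ℂ)) * (x s * ∏ t ∈ univ.erase s, x t) *
        ∏ t, (1 - p * (shiftVar p x k s / x t)) := by
    rw [mul_prod_erase univ _ (mem_univ s), mul_prod_erase univ (fun _ => (-1 : ℂ)) (mem_univ s),
      ← prod_mul_distrib, ← prod_mul_distrib]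
    refine prod_congr rfl fun t _ => ?_
    rw [shiftVar_add_single_self]
    have := hx t
    field_simp
    ring
  have hC : ∏ t ∈ univ.erase s, shiftVar p x k t / (shiftVar p x k t - shiftVar p x k s) =
      (∏ t ∈ univ.erase s, p ^ k t) * (∏ t ∈ univ.erase s, x t) *
      (∏ t ∈ univ.erase s, (shiftVar p x k t - shiftVar p x k s))⁻¹ := by
    rw [← prod_inv_distrib, ← prod_mul_distrib, ← prod_mul_distrib]
    exact prod_congr rfl fun t _ => by rw [shiftVar]; ring
  have hD : (∏ t, (1 - a t * (shiftVar p x k s / x t))) *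
      ∏ t ∈ univ.erase s, (1 - a r * (shiftVar p x k t / x r)) =
      (∏ t, (1 - a r * (shiftVar p x k t / x r))) *
      ∏ t ∈ univ.erase r, (1 - a t * (x t)⁻¹ * shiftVar p x k s) := by
    rw [← mul_prod_erase univ _ (mem_univ r),
      ← mul_prod_erase univ (fun t => 1 - a r * (shiftVar p x k t / x r)) (mem_univ s)]
    have : ∏ t ∈ univ.erase r, (1 - a t * (x t)⁻¹ * shiftVar p x k s) =
        ∏ t ∈ univ.erase r, (1 - a t * (shiftVar p x k s / x t)) :=
      prod_congr rfl fun t _ => by ring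
    rw [this]
    ring
  have hE : (∏ t ∈ univ.erase s, (-1 : ℂ)) * (∏ t ∈ univ.erase s, (-1 : ℂ)) = 1 := by
    rw [← prod_mul_distrib]
    simp
  have hF := milneLillyTerm_update hp hx a z k r
  have hne : ∏ t, (1 - p * (shiftVar p x k s / x t)) ≠ 0 := prod_ne_zero_iff.2 fun t _ => by
    have := one_sub_shiftVar_ne_zero hp1 hx hxx s t (k s)
    rw [shiftVar]
    convert this using 1
    ring
  have hne2 : ∏ t ∈ univ.erase s, (shiftVar p x k t - p * shiftVar p x k s) ≠ 0 :=
    prod_ne_zero_iff.2 fun t ht => by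
      rw [← shiftVar_add_single_self, ← shiftVar_add_single_of_ne p x k (mem_erase.1 ht).1]
      exact sub_ne_zero.2 (hinj.ne (mem_erase.1 ht).1)
  rw [milneLillyTerm_add_single hp hx hxx, hA, hB, partialTerm, hC, prod_div_distrib,
    mul_right_comm (-(a r * (x r)⁻¹ * z) * _), mul_assoc (-(a r * (x r)⁻¹ * z)) _ (∏ t, _), hF]
  generalize (∏ t ∈ univ.erase s, (-1 : ℂ)) = e at *
  generalize (∏ t, (1 - p * (shiftVar p x k s / x t))) = P1 at *
  generalize ∏ t ∈ univ.erase s, (shiftVar p x k t - p * shiftVar p x k s) = P2 at *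
  generalize ∏ t ∈ univ.erase s, (shiftVar p x k t - shiftVar p x k s) = P3 at *
  generalize ∏ t ∈ univ.erase s, (1 - a r * (shiftVar p x k t / x r)) = P4 at *
  generalize (∏ t, (1 - a t * (shiftVar p x k s / x t))) = P5 at *
  generalize (∏ t, (1 - a r * (shiftVar p x k t / x r))) = P6 at *
  generalize ∏ t ∈ univ.erase r, (1 - a t * (x t)⁻¹ * shiftVar p x k s) = P7 at *
  generalize ∏ t ∈ univ.erase s, p ^ k t = P8 at *
  generalize ∏ t ∈ univ.erase s, x t = P9 at *
  generalize milneLillyTerm p x a z k = T at *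
  have h1 : P1 / P1 = 1 := div_self hne
  have h2 : P2 / P2 = 1 := div_self hne2
  have h3 : x s * (x s)⁻¹ = 1 := mul_inv_cancel₀ (hx s)
  calc _ = -(a r * (x r)⁻¹ * z) * T * (P5 * P4) * P8 * P9 * P3⁻¹ * (e * e) * (P1 / P1) *
        (P2 / P2) * (x s * (x s)⁻¹) := by ring
    _ = _ := by rw [hD, hE, h1, h2, h3]; ring

theorem milneLillyTerm_sub_update_mul {n : ℕ} {p : ℂ} (hp : p ≠ 0) {x : Fin n → ℂ}
    (hx : ∀ r, x r ≠ 0) (hxx : ∀ r s, r ≠ s → ∀ i : ℕ, p ^ i * (x r / x s) ≠ 1)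
    (a : Fin n → ℂ) (z : ℂ) (k : Fin n → ℕ) (r : Fin n) :
    (milneLillyTerm p x a z k - milneLillyTerm p x (Function.update a r (p * a r)) z k) *
      ∏ t, (1 - a r * (x t / x r)) =
    ∑ s, milneLillyTerm p x a z k *
      (a r / x r * (∏ t, (shiftVar p x k s - x t)) *
        ∏ t ∈ univ.erase s, (1 - a r / x r * shiftVar p x k t) /
          (shiftVar p x k s - shiftVar p x k t)) := by
  rw [← mul_sum, ← prod_sub_prod_eq_sum (shiftVar_injective hp hx hxx k) x (a r / x r), sub_mul,
    milneLillyTerm_update hp hx, ← mul_sub]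
  simp only [div_mul_eq_mul_div, mul_div_assoc]

theorem sum_piAntidiag_succ {n : ℕ} (s : Fin n) (N : ℕ) (f : (Fin n → ℕ) → ℂ)
    (hf : ∀ k, k s = 0 → f k = 0) :
    ∑ k ∈ piAntidiag univ (N + 1), f k = ∑ k ∈ piAntidiag univ N, f (k + Pi.single s 1) := by
  symm
  have hinj : Function.Injective fun k : Fin n → ℕ => k + Pi.single s 1 := fun k l h =>
    add_right_cancel h
  refine (sum_map (piAntidiag univ N) ⟨_, hinj⟩ f).symm.trans ?_
  refine sum_subset ?_ fun k hk hk' => hf k ?_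
  · intro k hk
    obtain ⟨l, hl, rfl⟩ := mem_map.1 hk
    simp only [mem_piAntidiag, mem_univ, implies_true, and_true] at hl ⊢
    simp [sum_add_distrib, hl]
  · by_contra h0
    refine hk' (mem_map.2 ⟨k - Pi.single s 1, ?_, ?_⟩)
    · simp only [mem_piAntidiag, mem_univ, implies_true, and_true] at hk ⊢
      change ∑ i, k i = N + 1 at hk
      change ∑ i, (k - Pi.single s 1 : Fin n → ℕ) i = N
      have : ∑ i, k i = ∑ i, ((k - Pi.single s 1 : Fin n → ℕ) + Pi.single s 1 : Fin n → ℕ) i := by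
        refine sum_congr rfl fun i _ => ?_
        rcases eq_or_ne i s with rfl | hi
        · simp; omega
        · simp [hi]
      simp only [Pi.add_apply, sum_add_distrib, sum_pi_single', mem_univ, if_true] at this
      omega
    · funext i
      rcases eq_or_ne i s with rfl | hi
      · simp; omega
      · simp [hi]

theorem continuous_milneLillyTerm {n : ℕ} (p : ℂ) (x : Fin n → ℂ) (z : ℂ) (k : Fin n → ℕ) :
    Continuous fun a => milneLillyTerm p x a z k := by
  unfold milneLillyTerm qFac
  fun_prop

/-- The homogeneous part of degree `N` of the Milne-Lilly series. -/
def milneLillyCoeff {n : ℕ} (p : ℂ) (x a : Fin n → ℂ) (z : ℂ) (N : ℕ) : ℂ :=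
  ∑ k ∈ piAntidiag univ N, milneLillyTerm p x a z k

theorem continuous_milneLillyCoeff {n : ℕ} (p : ℂ) (x : Fin n → ℂ) (z : ℂ) (N : ℕ) :
    Continuous fun a => milneLillyCoeff p x a z N :=
  continuous_finsetSum _ fun k _ => continuous_milneLillyTerm p x z k

theorem milneLillyCoeff_succ_of_ne_zero {n : ℕ} {p : ℂ} (hp : p ≠ 0) (hp1 : ‖p‖ < 1)
    {x : Fin n → ℂ}
    (hx : ∀ r, x r ≠ 0) (hxx : ∀ r s, r ≠ s → ∀ i : ℕ, p ^ i * (x r / x s) ≠ 1)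
    (a : Fin n → ℂ) (z : ℂ) (r : Fin n) (ha : ∏ t, (1 - a r * (x t / x r)) ≠ 0) (N : ℕ) :
    milneLillyCoeff p x a z (N + 1) =
      milneLillyCoeff p x (Function.update a r (p * a r)) z (N + 1) -
      a r * (x r)⁻¹ * z * milneLillyCoeff p x (Function.update a r (p * a r)) z N := by
  have h : (milneLillyCoeff p x a z (N + 1) -
      milneLillyCoeff p x (Function.update a r (p * a r)) z (N + 1)) *
        ∏ t, (1 - a r * (x t / x r)) =
      -(a r * (x r)⁻¹ * z) * milneLillyCoeff p x (Function.update a r (p * a r)) z N *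
        ∏ t, (1 - a r * (x t / x r)) := by
    simp only [milneLillyCoeff]
    rw [← sum_sub_distrib, sum_mul, sum_congr rfl fun k _ =>
      milneLillyTerm_sub_update_mul hp hx hxx a z k r, sum_comm, mul_sum, sum_mul,
      sum_congr rfl fun s _ => sum_piAntidiag_succ s N _ fun k hk => ?_]
    · rw [sum_comm]
      refine sum_congr rfl fun k _ => ?_
      rw [← sum_partialTerm hp hx hxx, sum_mul]
      exact sum_congr rfl fun s _ => milneLillyTerm_mul_eq_partialTerm hp hp1 hx hxx a z k r s
    · have : ∏ t, (shiftVar p x k s - x t) = 0 :=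
        prod_eq_zero (mem_univ s) (by simp [shiftVar, hk])
      rw [this]
      ring
  linear_combination mul_right_cancel₀ ha h

theorem milneLillyCoeff_succ {n : ℕ} {p : ℂ} (hp : p ≠ 0) (hp1 : ‖p‖ < 1)
    {x : Fin n → ℂ}
    (hx : ∀ r, x r ≠ 0) (hxx : ∀ r s, r ≠ s → ∀ i : ℕ, p ^ i * (x r / x s) ≠ 1)
    (a : Fin n → ℂ) (z : ℂ) (r : Fin n) (N : ℕ) :
    milneLillyCoeff p x a z (N + 1) =
      milneLillyCoeff p x (Function.update a r (p * a r)) z (N + 1) -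
      a r * (x r)⁻¹ * z * milneLillyCoeff p x (Function.update a r (p * a r)) z N := by
  have hu : Continuous fun c : ℂ => Function.update a r c := continuous_const.update r continuous_id
  have hu' : Continuous fun c : ℂ => Function.update a r (p * c) :=
    continuous_const.update r (continuous_const.mul continuous_id)
  have key := Continuous.ext_on (f := fun c : ℂ => milneLillyCoeff p x (Function.update a r c) z (N + 1))
    (g := fun c : ℂ => milneLillyCoeff p x (Function.update a r (p * c)) z (N + 1) -
      c * (x r)⁻¹ * z * milneLillyCoeff p x (Function.update a r (p * c)) z N)
    (s := (Set.range fun t => x r / x t)ᶜ)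
    ((Set.finite_range _).countable.dense_compl ℝ)
    ((continuous_milneLillyCoeff p x z _).comp hu)
    (((continuous_milneLillyCoeff p x z _).comp hu').sub
      (((continuous_id.mul continuous_const).mul continuous_const).mul
        ((continuous_milneLillyCoeff p x z _).comp hu')))
    (fun c hc => by
      have := milneLillyCoeff_succ_of_ne_zero hp hp1 hx hxx (Function.update a r c) z r
        (prod_ne_zero_iff.2 fun t _ h => hc ⟨t, ?_⟩) N
      · simpa using this
      · rw [Function.update_self] at h
        have h1 := hx t
        have h2 := hx r
        field_simp at h ⊢
        linear_combination h)
  simpa using congrFun key (a r)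

theorem norm_qFac_le {p : ℂ} (hp1 : ‖p‖ < 1) {A : ℂ} {R : ℝ} (hA : ‖A‖ ≤ R) (k : ℕ) :
    ‖qFac A p k‖ ≤ Real.exp (R * (1 - ‖p‖)⁻¹) := by
  have hR : 0 ≤ R := (norm_nonneg A).trans hA
  rw [qFac, norm_prod]
  calc ∏ i ∈ range k, ‖1 - A * p ^ i‖ ≤ ∏ i ∈ range k, (1 + R * ‖p‖ ^ i) := by
        refine prod_le_prod (fun _ _ => norm_nonneg _) fun i _ => ?_
        refine (norm_sub_le _ _).trans ?_
        rw [norm_one, norm_mul, norm_pow]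
        gcongr
    _ ≤ Real.exp (∑ i ∈ range k, R * ‖p‖ ^ i) :=
        Real.prod_one_add_le_exp_sum _ fun i => by positivity
    _ ≤ _ := by
        rw [← mul_sum, ← tsum_geometric_of_lt_one (norm_nonneg p) hp1]
        gcongr
        exact (summable_geometric_of_lt_one (norm_nonneg p) hp1).sum_le_tsum _ fun i _ => by
          positivity

theorem summable_norm_neg_mul_pow {p : ℂ} (hp1 : ‖p‖ < 1) (A : ℂ) :
    Summable fun i : ℕ => ‖-(A * p ^ i)‖ := by
  simp only [norm_neg, norm_mul, norm_pow]
  exact (summable_geometric_of_lt_one (norm_nonneg p) hp1).mul_left _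

theorem tendsto_qFac {p : ℂ} (hp1 : ‖p‖ < 1) (A : ℂ) :
    Tendsto (qFac A p) atTop (𝓝 (qFacInf A p)) := by
  have := (multipliable_one_add_of_summable
    (summable_norm_neg_mul_pow hp1 A)).tendsto_prod_tprod_nat
  simp only [← sub_eq_add_neg] at this
  exact this

theorem qFacInf_ne_zero {p : ℂ} (hp1 : ‖p‖ < 1) {A : ℂ} (hA : ∀ i : ℕ, 1 - A * p ^ i ≠ 0) :
    qFacInf A p ≠ 0 := by
  have := tprod_one_add_ne_zero_of_summable (f := fun i : ℕ => -(A * p ^ i))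
    (by simpa only [← sub_eq_add_neg] using hA) (summable_norm_neg_mul_pow hp1 A)
  simp only [← sub_eq_add_neg] at this
  exact this

theorem qFacInf_ne_zero_of_norm_lt_one {p : ℂ} (hp1 : ‖p‖ < 1) {A : ℂ} (hA : ‖A‖ < 1) :
    qFacInf A p ≠ 0 := by
  refine qFacInf_ne_zero hp1 fun i h => ?_
  have h1 : ‖A * p ^ i‖ = 1 := by rw [← sub_eq_zero.1 h, norm_one]
  rw [norm_mul, norm_pow] at h1
  have h2 : ‖A‖ * ‖p‖ ^ i ≤ ‖A‖ * 1 := by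
    gcongr
    exact pow_le_one₀ (norm_nonneg p) hp1.le
  linarith

theorem exists_norm_inv_qFac_le {p : ℂ} (hp1 : ‖p‖ < 1) {A : ℂ}
    (hA : ∀ i : ℕ, 1 - A * p ^ i ≠ 0) : ∃ B : ℝ, ∀ k, ‖(qFac A p k)⁻¹‖ ≤ B := by
  have h := (tendsto_qFac hp1 A).inv₀ (qFacInf_ne_zero hp1 hA)
  obtain ⟨B, hB⟩ := (Metric.isBounded_range_of_tendsto _ h).exists_norm_le
  exact ⟨B, fun k => hB _ ⟨k, rfl⟩⟩

theorem summable_prod_pow {n : ℕ} {ρ : Fin n → ℝ} (h0 : ∀ r, 0 ≤ ρ r) (h1 : ∀ r, ρ r < 1) :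
    Summable fun k : Fin n → ℕ => ∏ r, ρ r ^ k r := by
  refine summable_of_sum_le (c := ∏ r, (1 - ρ r)⁻¹)
    (fun k => prod_nonneg fun r _ => pow_nonneg (h0 r) _) fun u => ?_
  obtain ⟨K, hK⟩ : ∃ K, ∀ k ∈ u, ∀ r, k r < K := by
    refine ⟨∑ k ∈ u, ∑ r, k r + 1, fun k hk r => Nat.lt_succ_of_le ?_⟩
    exact (single_le_sum (f := k) (fun _ _ => Nat.zero_le _) (mem_univ r)).trans
      (single_le_sum (f := fun k : Fin n → ℕ => ∑ r, k r) (fun _ _ => Nat.zero_le _) hk)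
  calc ∑ k ∈ u, ∏ r, ρ r ^ k r
      ≤ ∑ k ∈ Fintype.piFinset fun _ : Fin n => range K, ∏ r, ρ r ^ k r :=
        sum_le_sum_of_subset_of_nonneg
          (fun k hk => Fintype.mem_piFinset.2 fun r => mem_range.2 (hK k hk r))
          fun k _ _ => prod_nonneg fun r _ => pow_nonneg (h0 r) _
    _ = ∏ r, ∑ i ∈ range K, ρ r ^ i := (prod_univ_sum _ _).symm
    _ ≤ _ := prod_le_prod (fun r _ => sum_nonneg fun i _ => pow_nonneg (h0 r) _) fun r _ => by
        rw [← tsum_geometric_of_lt_one (h0 r) (h1 r)]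
        exact (summable_geometric_of_lt_one (h0 r) (h1 r)).sum_le_tsum _ fun i _ =>
          pow_nonneg (h0 r) _

theorem exists_norm_milneLillyTerm_le {n : ℕ} {p : ℂ} (hp : p ≠ 0) (hp1 : ‖p‖ < 1)
    {x : Fin n → ℂ}
    (hx : ∀ r, x r ≠ 0) (hxx : ∀ r s, r ≠ s → ∀ i : ℕ, p ^ i * (x r / x s) ≠ 1)
    (z : ℂ) (R : ℝ) :
    ∃ B : ℝ, ∀ a : Fin n → ℂ, (∀ s, ‖a s‖ ≤ R) → ∀ k,
      ‖milneLillyTerm p x a z k‖ ≤ B * ∏ r, ‖z / x r‖ ^ k r := by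
  choose B hB using fun r s => exists_norm_inv_qFac_le hp1
    fun i => one_sub_shiftVar_ne_zero hp1 hx hxx r s i
  refine ⟨(∏ i, ∏ j ∈ Ioi i, (‖x j‖ + ‖x i‖) / ‖x j - x i‖) *
    (∏ r, ∏ s, Real.exp (R * ‖x r / x s‖ * (1 - ‖p‖)⁻¹) * B r s), fun a ha k => ?_⟩
  have hsv : ∀ r, ‖shiftVar p x k r‖ ≤ ‖x r‖ := fun r => by
    rw [shiftVar, norm_mul, norm_pow]
    exact mul_le_of_le_one_left (norm_nonneg _) (pow_le_one₀ (norm_nonneg p) hp1.le)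
  have hz : ∏ r, (z / x r) ^ k r = z ^ vecSum k * ∏ r, ((x r) ^ k r)⁻¹ := by
    rw [vecSum, ← prod_pow_eq_pow_sum, ← prod_mul_distrib]
    exact prod_congr rfl fun r _ => by rw [div_pow, div_eq_mul_inv]
  have hterm : milneLillyTerm p x a z k =
      (∏ i, ∏ j ∈ Ioi i, (shiftVar p x k j - shiftVar p x k i) / (x j - x i)) *
      (∏ r, ∏ s, qFac (a s * (x r / x s)) p (k r) * (qFac (p * (x r / x s)) p (k r))⁻¹) *
      p ^ vecE2 k * ∏ r, (z / x r) ^ k r := by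
    rw [milneLillyTerm_eq hp hx, hz]
    simp_rw [prod_mul_distrib, prod_inv_distrib]
    ring
  rw [hterm, norm_mul, norm_mul, norm_mul, norm_prod, norm_prod, norm_prod, norm_pow]
  simp_rw [norm_prod, norm_pow]
  refine mul_le_mul_of_nonneg_right ?_ (prod_nonneg fun r _ => by positivity)
  refine (mul_le_of_le_one_right (by positivity) (pow_le_one₀ (norm_nonneg p) hp1.le)).trans ?_
  refine mul_le_mul ?_ ?_ (by positivity) (by positivity)
  · refine prod_le_prod (fun i _ => by positivity) fun i _ =>
      prod_le_prod (fun i _ => by positivity) fun j _ => ?_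
    rw [norm_div]
    gcongr
    exact (norm_sub_le _ _).trans (add_le_add (hsv j) (hsv i))
  · refine prod_le_prod (fun i _ => by positivity) fun i _ =>
      prod_le_prod (fun i _ => by positivity) fun j _ => ?_
    rw [norm_mul]
    refine mul_le_mul (norm_qFac_le hp1 ?_ _) (hB i j _) (norm_nonneg _) (Real.exp_pos _).le
    rw [norm_mul]
    exact mul_le_mul_of_nonneg_right (ha j) (norm_nonneg _)

theorem milneLillyTerm_zero {n : ℕ} {p : ℂ} (hp : p ≠ 0) {x : Fin n → ℂ}
    (hx : ∀ r, x r ≠ 0) (hxx : ∀ r s, r ≠ s → ∀ i : ℕ, p ^ i * (x r / x s) ≠ 1)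
    (a : Fin n → ℂ) (z : ℂ) : milneLillyTerm p x a z 0 = 1 := by
  have h0 : shiftVar p x 0 = x := by
    funext r
    simp [shiftVar]
  have hinj := shiftVar_injective hp hx hxx 0
  rw [h0] at hinj
  have : ∏ i, ∏ j ∈ Ioi i, (x j - x i) / (x j - x i) = 1 :=
    prod_eq_one fun i _ => prod_eq_one fun j hj =>
      div_self (sub_ne_zero.2 (hinj.ne (mem_Ioi.1 hj).ne'))
  rw [milneLillyTerm_eq hp hx, h0, this]
  simp [vecSum, vecE2, qFac_zero]

theorem milneLillyTerm_one_of_ne_zero {n : ℕ} {p : ℂ} (hp : p ≠ 0) {x : Fin n → ℂ}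
    (hx : ∀ r, x r ≠ 0) (z : ℂ) {k : Fin n → ℕ} (hk : k ≠ 0) :
    milneLillyTerm p x 1 z k = 0 := by
  obtain ⟨r, hr⟩ := Function.ne_iff.1 hk
  have : ∏ i, ∏ s, qFac ((1 : Fin n → ℂ) s * (x i / x s)) p (k i) = 0 :=
    prod_eq_zero (mem_univ r) <| prod_eq_zero (mem_univ r) <|
      prod_eq_zero (mem_range.2 (Nat.pos_of_ne_zero hr)) <| by simp [hx r]
  rw [milneLillyTerm_eq hp hx, this]
  simp

section Series

variable {n : ℕ} {p : ℂ} (hp : p ≠ 0) (hp1 : ‖p‖ < 1) {x : Fin n → ℂ}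
  (hx : ∀ r, x r ≠ 0) (hxx : ∀ r s, r ≠ s → ∀ i : ℕ, p ^ i * (x r / x s) ≠ 1)
  {z : ℂ} (hz : ∀ r, ‖z / x r‖ < 1)
include hp hp1 hx hxx hz

theorem summable_norm_milneLillyTerm (a : Fin n → ℂ) :
    Summable fun k => ‖milneLillyTerm p x a z k‖ := by
  obtain ⟨B, hB⟩ := exists_norm_milneLillyTerm_le hp hp1 hx hxx z (∑ s, ‖a s‖)
  exact ((summable_prod_pow (fun r => norm_nonneg (z / x r)) hz).mul_left B).of_nonneg_of_le
    (fun _ => norm_nonneg _) (hB a fun s =>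
      single_le_sum (f := fun s => ‖a s‖) (fun _ _ => norm_nonneg _) (mem_univ s))

theorem hasSum_milneLillyCoeff (a : Fin n → ℂ) :
    HasSum (milneLillyCoeff p x a z) (∑' k, milneLillyTerm p x a z k) := by
  have := (summable_norm_milneLillyTerm hp hp1 hx hxx hz a).of_norm.hasSum.tsum_fiberwise
    (vecSum (n := n))
  convert! this using 2 with N
  have hs : vecSum (n := n) ⁻¹' {N} = ((piAntidiag univ N : Finset (Fin n → ℕ)) : Set _) := by
    ext k
    simp [vecSum, mem_piAntidiag]
  rw [hs, milneLillyCoeff, Finset.tsum_subtype']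

theorem tsum_milneLillyTerm_update (a : Fin n → ℂ) (r : Fin n) :
    ∑' k, milneLillyTerm p x a z k = (1 - a r * (z / x r)) *
      ∑' k, milneLillyTerm p x (Function.update a r (p * a r)) z k := by
  have h1 := hasSum_milneLillyCoeff hp hp1 hx hxx hz a
  have h2 := hasSum_milneLillyCoeff hp hp1 hx hxx hz (Function.update a r (p * a r))
  have h0 : ∀ b : Fin n → ℂ, milneLillyCoeff p x b z 0 = 1 := fun b => by
    have := milneLillyTerm_zero hp hx hxx b z
    simp [milneLillyCoeff, this]
  have h3 := h1.summable.tsum_eq_zero_add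
  have h4 := h2.summable.tsum_eq_zero_add
  have h5 := (hasSum_nat_add_iff' 1).2 h2
  simp_rw [milneLillyCoeff_succ hp hp1 hx hxx a z r] at h3
  rw [(h5.summable).tsum_sub (h2.summable.mul_left _), tsum_mul_left, h0, h1.tsum_eq,
    h2.tsum_eq] at h3
  rw [h0, h2.tsum_eq] at h4
  linear_combination h3 - h4

theorem tsum_milneLillyTerm_update_zero (a : Fin n → ℂ) (r : Fin n) :
    ∑' k, milneLillyTerm p x a z k = qFacInf (a r * (z / x r)) p *
      ∑' k, milneLillyTerm p x (Function.update a r 0) z k := by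
  have hM : ∀ M : ℕ, ∑' k, milneLillyTerm p x a z k = qFac (a r * (z / x r)) p M *
      ∑' k, milneLillyTerm p x (Function.update a r (p ^ M * a r)) z k := by
    intro M
    induction M with
    | zero => simp [qFac_zero]
    | succ M ih =>
      rw [ih, tsum_milneLillyTerm_update hp hp1 hx hxx hz (Function.update a r (p ^ M * a r)) r,
        qFac_succ, Function.update_self, Function.update_idem, pow_succ', mul_assoc p]
      ring
  obtain ⟨B, hB⟩ := exists_norm_milneLillyTerm_le hp hp1 hx hxx z (∑ s, ‖a s‖)
  have ha : ∀ s, ‖a s‖ ≤ ∑ s, ‖a s‖ := fun s =>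
    single_le_sum (f := fun s => ‖a s‖) (fun _ _ => norm_nonneg _) (mem_univ s)
  have hpow : Tendsto (fun M : ℕ => p ^ M * a r) atTop (𝓝 0) := by
    simpa using (tendsto_pow_atTop_nhds_zero_of_norm_lt_one hp1).mul_const (a r)
  have hlim := tendsto_tsum_of_dominated_convergence (𝓕 := atTop)
    (f := fun (M : ℕ) k => milneLillyTerm p x (Function.update a r (p ^ M * a r)) z k)
    (g := fun k => milneLillyTerm p x (Function.update a r 0) z k)
    ((summable_prod_pow (fun r => norm_nonneg (z / x r)) hz).mul_left B)
    (fun k => by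
      have := ((continuous_milneLillyTerm p x z k).comp
        (continuous_const.update r continuous_id : Continuous (Function.update a r))).tendsto 0
      exact this.comp hpow)
    (Eventually.of_forall fun M k => hB _ (fun s => by
      rcases eq_or_ne s r with rfl | hs
      · rw [Function.update_self, norm_mul, norm_pow]
        exact (mul_le_of_le_one_left (norm_nonneg _)
          (pow_le_one₀ (norm_nonneg p) hp1.le)).trans (ha s)
      · rw [Function.update_of_ne hs]
        exact ha s) k)
  refine tendsto_nhds_unique ?_ ((tendsto_qFac hp1 (a r * (z / x r))).mul hlim)
  simp_rw [← hM]
  exact tendsto_const_nhds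

theorem tsum_milneLillyTerm_eq_prod_mul (a : Fin n → ℂ) :
    ∑' k, milneLillyTerm p x a z k = (∏ r, qFacInf (a r * (z / x r)) p) *
      ∑' k, milneLillyTerm p x 0 z k := by
  have h : ∀ S : Finset (Fin n), ∑' k, milneLillyTerm p x a z k =
      (∏ r ∈ S, qFacInf (a r * (z / x r)) p) *
      ∑' k, milneLillyTerm p x (fun r => if r ∈ S then 0 else a r) z k := by
    intro S
    induction S using Finset.induction_on with
    | empty => simp
    | insert s S hs ih =>
      rw [ih, tsum_milneLillyTerm_update_zero hp hp1 hx hxx hz _ s, prod_insert hs, if_neg hs]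
      have : Function.update (fun r => if r ∈ S then 0 else a r) s 0 =
          fun r => if r ∈ insert s S then 0 else a r := by
        funext r
        rcases eq_or_ne r s with rfl | hr
        · simp
        · simp [hr]
      rw [this]
      ring
  simpa using! h univ

/-- The `q`-binomial theorem of type `A`. -/
theorem tsum_milneLillyTerm (a : Fin n → ℂ) :
    ∑' k, milneLillyTerm p x a z k =
      ∏ r, qFacInf (a r * (z / x r)) p / qFacInf (z / x r) p := by
  have h1 : ∑' k, milneLillyTerm p x 1 z k = 1 := by
    rw [tsum_eq_single 0 fun k hk => milneLillyTerm_one_of_ne_zero hp hx z hk,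
      milneLillyTerm_zero hp hx hxx]
  have h2 := tsum_milneLillyTerm_eq_prod_mul hp hp1 hx hxx hz 1
  have hne : ∏ r, qFacInf (z / x r) p ≠ 0 :=
    prod_ne_zero_iff.2 fun r _ => qFacInf_ne_zero_of_norm_lt_one hp1 (hz r)
  simp only [Pi.one_apply, one_mul] at h2
  rw [h1] at h2
  rw [tsum_milneLillyTerm_eq_prod_mul hp hp1 hx hxx hz a, prod_div_distrib, eq_div_iff hne,
    mul_assoc, mul_comm (∑' _, _), ← h2, mul_one]

end Series

theorem qPow_ne_zero (logq α : ℂ) : qPow logq α ≠ 0 := Complex.exp_ne_zero _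

theorem qPow_mul_natCast (logq α : ℂ) (k : ℕ) : qPow logq (α * k) = qPow logq α ^ k := by
  rw [qPow, qPow, ← Complex.exp_nat_mul]
  ring_nf

theorem milneLillyTerm_mul_right {n : ℕ} (p : ℂ) (x a : Fin n → ℂ) (z c : ℂ) (k : Fin n → ℕ) :
    milneLillyTerm p x a (z * c) k = milneLillyTerm p x a z k * c ^ vecSum k := by
  rw [milneLillyTerm, milneLillyTerm, mul_pow]
  ring

theorem qFacGen_div_qFacGen (logq β A B α : ℂ) :
    qFacGen logq β A α / qFacGen logq β B α =
      qFacInf A (qPow logq β) / qFacInf B (qPow logq β) *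
        (qFacInf (B * qPow logq (β * α)) (qPow logq β) /
          qFacInf (A * qPow logq (β * α)) (qPow logq β)) := by
  rw [qFacGen, qFacGen, div_div_div_eq]
  ring

/-- Summand of the double series interpolating between both sides of the transformation. -/
def heineDoubleTerm {n m : ℕ} (logq h t : ℂ) (x a : Fin n → ℂ) (z : ℂ)
    (y b : Fin m → ℂ) (w : ℂ) (kj : (Fin n → ℕ) × (Fin m → ℕ)) : ℂ :=
  milneLillyTerm (qPow logq h) x a z kj.1 * milneLillyTerm (qPow logq t) y b w kj.2 *
    qPow logq (h * t) ^ (vecSum kj.1 * vecSum kj.2)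

section Heine

variable {n m : ℕ} {logq h t : ℂ}
  (hh : ‖qPow logq h‖ < 1) (ht : ‖qPow logq t‖ < 1) (hht : ‖qPow logq (h * t)‖ < 1)
  {x : Fin n → ℂ} {z : ℂ} {y : Fin m → ℂ} {w : ℂ}
  (hx : ∀ r, x r ≠ 0) (hy : ∀ r, y r ≠ 0)
  (hz : ∀ r, ‖z / x r‖ < 1) (hw : ∀ r, ‖w / y r‖ < 1)
  (hxx : ∀ r s, r ≠ s → ∀ i : ℕ, qPow logq h ^ i * (x r / x s) ≠ 1)
  (hyy : ∀ r s, r ≠ s → ∀ i : ℕ, qPow logq t ^ i * (y r / y s) ≠ 1)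
include hh ht hht hx hy hz hw hxx hyy

theorem summable_heineDoubleTerm (a : Fin n → ℂ) (b : Fin m → ℂ) :
    Summable (heineDoubleTerm logq h t x a z y b w) := by
  have h1 := summable_norm_milneLillyTerm (qPow_ne_zero logq h) hh hx hxx hz a
  have h2 := summable_norm_milneLillyTerm (qPow_ne_zero logq t) ht hy hyy hw b
  refine Summable.of_norm_bounded (h1.mul_of_nonneg h2 (fun _ => norm_nonneg _)
    fun _ => norm_nonneg _) fun kj => ?_
  rw [heineDoubleTerm, norm_mul, norm_mul, norm_pow]
  exact mul_le_of_le_one_right (by positivity) (pow_le_one₀ (norm_nonneg _) hht.le)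

omit hh hx hz hxx in
theorem heineTerm_eq_tsum (a : Fin n → ℂ) (b : Fin m → ℂ) (k : Fin n → ℕ) :
    heineTerm logq h t x a z y b w k =
      (∏ r, qFacInf (w / y r) (qPow logq t) / qFacInf (b r * (w / y r)) (qPow logq t)) *
        ∑' j, heineDoubleTerm logq h t x a z y b w (k, j) := by
  have hQ : ‖qPow logq (h * t) ^ vecSum k‖ ≤ 1 := by
    rw [norm_pow]
    exact pow_le_one₀ (norm_nonneg _) hht.le
  have hw' : ∀ r, ‖w * qPow logq (h * t) ^ vecSum k / y r‖ < 1 := fun r => by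
    rw [mul_div_right_comm, norm_mul]
    exact (mul_le_of_le_one_right (norm_nonneg _) hQ).trans_lt (hw r)
  have key := tsum_milneLillyTerm (qPow_ne_zero logq t) ht hy hyy hw' b
  have hpow : qPow logq (t * (h * (vecSum k : ℂ))) = qPow logq (h * t) ^ vecSum k := by
    rw [← qPow_mul_natCast]
    ring_nf
  simp only [heineTerm, heineDoubleTerm, qFacGen_div_qFacGen, hpow]
  rw [prod_mul_distrib]
  simp_rw [mul_assoc (milneLillyTerm (qPow logq h) x a z k)]
  rw [tsum_mul_left]
  simp_rw [pow_mul, ← milneLillyTerm_mul_right]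
  rw [key]
  have : ∀ r, w * qPow logq (h * t) ^ vecSum k / y r = w / y r * qPow logq (h * t) ^ vecSum k :=
    fun r => by ring
  simp_rw [this, ← mul_assoc]
  ring

theorem summable_heineTerm (a : Fin n → ℂ) (b : Fin m → ℂ) :
    Summable fun k => heineTerm logq h t x a z y b w k := by
  simp_rw [heineTerm_eq_tsum ht hht hy hw hyy a b]
  exact (summable_heineDoubleTerm hh ht hht hx hy hz hw hxx hyy a b).prod.mul_left _

omit hh hx hz hxx in
theorem tsum_heineTerm (a : Fin n → ℂ) (b : Fin m → ℂ) :
    ∑' k, heineTerm logq h t x a z y b w k =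
      (∏ r, qFacInf (w / y r) (qPow logq t) / qFacInf (b r * (w / y r)) (qPow logq t)) *
        ∑' k, ∑' j, heineDoubleTerm logq h t x a z y b w (k, j) := by
  simp_rw [heineTerm_eq_tsum ht hht hy hw hyy a b]
  exact tsum_mul_left

end Heine

end

theorem mainTheorem1 (n m : ℕ) (logq h t : ℂ)
    (hh : 0 < ‖qPow logq h‖ ∧ ‖qPow logq h‖ < 1)
    (ht : 0 < ‖qPow logq t‖ ∧ ‖qPow logq t‖ < 1)
    (hht : 0 < ‖qPow logq (h * t)‖ ∧ ‖qPow logq (h * t)‖ < 1)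
    (x a : Fin n → ℂ) (z : ℂ) (y b : Fin m → ℂ) (w : ℂ)
    (hx : ∀ r, x r ≠ 0) (hy : ∀ r, y r ≠ 0)
    (hz : ∀ r, ‖z / x r‖ < 1) (hw : ∀ r, ‖w / y r‖ < 1)
    -- no denominator on either side vanishes
    (hxx : ∀ r s, r ≠ s → ∀ i : ℕ, qPow logq h ^ i * (x r / x s) ≠ 1)
    (hyy : ∀ r s, r ≠ s → ∀ i : ℕ, qPow logq t ^ i * (y r / y s) ≠ 1)
    (ha : ∀ r, ∀ i : ℕ, a r * (z / x r) * qPow logq h ^ i ≠ 1)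
    (hb : ∀ r, ∀ i : ℕ, b r * (w / y r) * qPow logq t ^ i ≠ 1) :
    Summable (fun k : Fin n → ℕ => heineTerm logq h t x a z y b w k) ∧
    Summable (fun j : Fin m → ℕ => heineTerm logq t h y b w x a z j) ∧
    ∑' k : Fin n → ℕ, heineTerm logq h t x a z y b w k =
      (∏ r, qFacInf (w / y r) (qPow logq t) / qFacInf (b r * (w / y r)) (qPow logq t)) *
      (∏ r, qFacInf (a r * (z / x r)) (qPow logq h) / qFacInf (z / x r) (qPow logq h)) *
      ∑' j : Fin m → ℕ, heineTerm logq t h y b w x a z j := by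
  have hth : ‖qPow logq (t * h)‖ < 1 := by rw [mul_comm]; exact hht.2
  refine ⟨summable_heineTerm hh.2 ht.2 hht.2 hx hy hz hw hxx hyy a b,
    summable_heineTerm ht.2 hh.2 hth hy hx hw hz hyy hxx b a, ?_⟩
  rw [tsum_heineTerm ht.2 hht.2 hy hw hyy a b,
    tsum_heineTerm hh.2 hth hx hz hxx b a]
  have hsymm : ∀ k j, heineDoubleTerm logq t h y b w x a z (j, k) =
      heineDoubleTerm logq h t x a z y b w (k, j) := fun k j => by
    simp only [heineDoubleTerm]
    rw [mul_comm t h, mul_comm (vecSum j), mul_comm (milneLillyTerm _ y b w j)]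
  simp_rw [hsymm]
  have hone : (∏ r, qFacInf (a r * (z / x r)) (qPow logq h) / qFacInf (z / x r) (qPow logq h)) *
      ∏ r, qFacInf (z / x r) (qPow logq h) / qFacInf (a r * (z / x r)) (qPow logq h) = 1 := by
    rw [← Finset.prod_mul_distrib]
    refine Finset.prod_eq_one fun r _ => ?_
    have h1 := qFacInf_ne_zero_of_norm_lt_one hh.2 (hz r)
    have h2 : qFacInf (a r * (z / x r)) (qPow logq h) ≠ 0 :=
      qFacInf_ne_zero hh.2 fun i => sub_ne_zero.2 (ha r i).symm
    rw [div_mul_div_comm, mul_comm, div_self (mul_ne_zero h1 h2)]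
  rw [mul_assoc, ← mul_assoc _ _ (∑' _, _), hone, one_mul]
  exact congrArg _ (Summable.tsum_comm (f := fun k j => heineDoubleTerm logq h t x a z y b w (k, j))
    (summable_heineDoubleTerm hh.2 ht.2 hht.2 hx hy hz hw hxx hyy a b)).symm
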